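/- Let $\Lambda^2=\{(a,b): a\in\mathbb Z_{\ge1},\ b\in\mathbb Z_{\ge0}\}$ be the set of compositions into at most two parts ($(a,0)$ being the one-part composition $a$), where $(a,b)$ has degree $a+b$. For $N\ge 0$ let $J_N$ be the set of finite multisets of elements of $\Lambda^2$ whose degrees, counted with multiplicity, sum to $N$, and let $J_N^{\pm}=\bigsqcup_{P+M=N} J_P\times J_M$ be the set of signed such multisets of total degree $N$. A plane partition is an array $(\pi_{i,j})_{i,j\ge 0}$ of non-negative integers with finitely many non-zero entries, weakly decreasing along every row and every column; it is a plane partition of $\sum_{i,j}\pi_{i,j}$. Then: (1) for every $k\ge1$ there are exactly $k$ elements of $\Lambda^2$ of degree $k$; (2) every $J_N$ is finite, and in $\mathbb Z[[x]]$ $$\sum_{N\ge0}|J_N|\,x^N=\prod_{k\ge1}\frac{1}{(1-x^k)^{k}};$$ (3) for every $N\ge 0$ the set of plane partitions of $N$ is finite, and $|J_N|$ is the number of plane partitions of $N$; (4) for every $N\ge 0$ the set $J_N^{\pm}$ is finite and is in bijection with the set of ordered pairs $(\pi,\pi')$ of plane partitions such that the sum of all entries of $\pi$ and $\pi'$ is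 $N$; moreover $\sum_{N\ge0}|J_N^{\pm}|\,x^N=\bigl(\sum_{N\ge0}|J_N|\,x^N\bigr)^2$. -/

import Mathlib

open scoped PowerSeries.WithPiTopology

namespace LoopBraid

/-- `J_N(S)`: the multisets on `S` of total degree `N`, for a degree function `d` on `S` with
positive values (so that a multiplicity function of finite total degree has finite support). -/
def JOn {S : Type*} (d : S → ℕ+) (N : ℕ) : Set (Multiset S) :=
  {f | (f.map fun s => (d s : ℕ)).sum = N}

/-- `J_{P,M}(S) = J_P(S) × J_M(S)`. -/
def JPairOn {S : Type*} (d : S → ℕ+) (P M : ℕ) : Set (Multiset S × Multiset S) :=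
  JOn d P ×ˢ JOn d M

/-- `J_N^±(S) = ⊔_{P + M = N} J_{P,M}(S)`: the signed multisets on `S` of total degree `N`.
The union is disjoint, because a pair of multisets determines `P` and `M`. -/
def JSignedOn {S : Type*} (d : S → ℕ+) (N : ℕ) : Set (Multiset S × Multiset S) :=
  ⋃ q ∈ Finset.HasAntidiagonal.antidiagonal N, JPairOn d q.1 q.2

/-- Compositions into at most two parts: `(a, b)` with `a ≥ 1` and `b ≥ 0`, where `(a, 0)` stands
for the one-part composition `a`. -/
abbrev TwoPartComposition : Type := ℕ+ × ℕ

/-- The degree `a + b` of the composition `(a, b)`. -/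
def TwoPartComposition.degree (c : TwoPartComposition) : ℕ+ :=
  ⟨(c.1 : ℕ) + c.2, Nat.add_pos_left c.1.pos c.2⟩

/-- `J_N`: multisets of compositions into at most two parts, of total degree `N`. -/
def J (N : ℕ) : Set (Multiset TwoPartComposition) :=
  JOn TwoPartComposition.degree N

/-- `J_N^±`: signed multisets of compositions into at most two parts, of total degree `N`. -/
def JSigned (N : ℕ) : Set (Multiset TwoPartComposition × Multiset TwoPartComposition) :=
  JSignedOn TwoPartComposition.degree N

/-- A plane partition: a finitely supported array `(π i j)` of natural numbers, `i, j ≥ 0`, that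
is weakly decreasing along rows and along columns. -/
structure PlanePartition where
  /-- The entries of the array. -/
  entries : ℕ × ℕ →₀ ℕ
  row_le : ∀ i j, entries (i, j + 1) ≤ entries (i, j)
  col_le : ∀ i j, entries (i + 1, j) ≤ entries (i, j)

/-- The total degree of a plane partition: the sum of its entries. -/
def PlanePartition.size (π : PlanePartition) : ℕ :=
  π.entries.sum fun _ m => m

/-- The plane partitions of `N`. -/
def planePartitionsOf (N : ℕ) : Set PlanePartition :=
  {π | π.size = N}

/-- The ordered pairs of plane partitions of total degree `N`. -/
def planePartitionPairsOf (N : ℕ) : Set (PlanePartition × PlanePartition) :=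
  {p | p.1.size + p.2.size = N}

end LoopBraid

namespace LoopBraid

open Finset

/-! The equality of `|J_N|` with the number of plane partitions is proved bijectively. Both sides
are finite at degree `N`: a plane partition of `N` lives in an `N × N` box, and a multiset in `J_N`
uses only the compositions `(i + 1, k)` with `i, k < N`. So it suffices to match box plane
partitions with arbitrary arrays on the box, cell `(i, k)` having weight `i + k + 1`, the degree of
that composition.

The matching dismantles the box one corner at a time, along the top row and then row by row.
Removing the corner `(0, j)` records its excess over the larger of its right and lower neighbours
and toggles the rest of its diagonal (`toggleEquiv`). Toggles are involutions, so nothing is lost.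
By `truncWeight_toggle`, a corrected sum of entries drops by `j + t + 1` times the record, where `t`
counts the rows already dropped. The correction vanishes on the full box, so
`exists_equiv_box_boxSum` follows.

The product formula is independent of this: expanding geometric series counts multiplicity functions
on compositions. Signed multisets follow by gluing the bijections over all degrees. -/

/-- Arrays in an `R × n` box, vanishing on the first `j` cells of the top row, that are weakly
decreasing along rows and columns away from these cells. -/
structure IsTruncated (R n j : ℕ) (p : ℕ → ℕ → ℕ) : Prop where
  zero : ∀ i k, R ≤ i ∨ n ≤ k ∨ (i = 0 ∧ k < j) → p i k = 0
  row : ∀ i k, 0 < i ∨ j ≤ k → p i (k + 1) ≤ p i k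
  col : ∀ i k, 0 < i ∨ j ≤ k → p (i + 1) k ≤ p i k

/-- The arrays satisfying `IsTruncated`. -/
abbrev TruncatedArray (R n j : ℕ) : Type := {p : ℕ → ℕ → ℕ // IsTruncated R n j p}

/-! ### Toggling a diagonal -/

/-- Reflect each entry below the top row on the `j`-th diagonal within the interval allowed by its
neighbours, and put `c` in the top row. -/
def toggleDiag (j : ℕ) (p : ℕ → ℕ → ℕ) (c : ℕ) (i k : ℕ) : ℕ :=
  if k = i + j then
    if i = 0 then c
    else max (p (i + 1) k) (p i (k + 1)) + min (p (i - 1) k) (p i (k - 1)) - p i k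
  else p i k

theorem toggleDiag_of_ne {j : ℕ} {p : ℕ → ℕ → ℕ} {c i k : ℕ} (h : k ≠ i + j) :
    toggleDiag j p c i k = p i k := if_neg h

theorem toggleDiag_zero (j : ℕ) (p : ℕ → ℕ → ℕ) (c : ℕ) : toggleDiag j p c 0 j = c := by
  simp [toggleDiag]

theorem toggleDiag_succ (j : ℕ) (p : ℕ → ℕ → ℕ) (c i : ℕ) :
    toggleDiag j p c (i + 1) (i + 1 + j) =
      max (p (i + 2) (i + 1 + j)) (p (i + 1) (i + 2 + j)) +
        min (p i (i + 1 + j)) (p (i + 1) (i + j)) - p (i + 1) (i + 1 + j) := by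
  have h : i + 1 + j - 1 = i + j := by omega
  have h' : i + 1 + j + 1 = i + 2 + j := by omega
  simp [toggleDiag, h, h']

/-- The bounds on the entries of a diagonal below the top row. -/
def DiagBounds (j : ℕ) (p : ℕ → ℕ → ℕ) : Prop :=
  ∀ i, max (p (i + 2) (i + 1 + j)) (p (i + 1) (i + 2 + j)) ≤ p (i + 1) (i + 1 + j) ∧
    p (i + 1) (i + 1 + j) ≤ min (p i (i + 1 + j)) (p (i + 1) (i + j))

theorem IsTruncated.diagBounds {R n j : ℕ} {p : ℕ → ℕ → ℕ} (hp : IsTruncated R n j p) :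
    DiagBounds j p := by
  intro i
  have h1 := hp.row (i + 1) (i + 1 + j) (by omega)
  have h2 := hp.col (i + 1) (i + 1 + j) (by omega)
  have h3 := hp.row (i + 1) (i + j) (by omega)
  have h4 := hp.col i (i + 1 + j) (by omega)
  rw [show i + 1 + j + 1 = i + 2 + j by omega] at h1
  rw [show i + j + 1 = i + 1 + j by omega] at h3
  exact ⟨max_le h2 h1, le_min h4 h3⟩

theorem IsTruncated.diagBounds' {R n j : ℕ} {p : ℕ → ℕ → ℕ} (hp : IsTruncated R n (j + 1) p) :
    DiagBounds j p := by
  intro i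
  have h1 := hp.row (i + 1) (i + 1 + j) (by omega)
  have h2 := hp.col (i + 1) (i + 1 + j) (by omega)
  have h3 := hp.row (i + 1) (i + j) (by omega)
  have h4 := hp.col i (i + 1 + j) (by omega)
  rw [show i + 1 + j + 1 = i + 2 + j by omega] at h1
  rw [show i + j + 1 = i + 1 + j by omega] at h3
  exact ⟨max_le h2 h1, le_min h4 h3⟩

theorem DiagBounds.toggleDiag {j : ℕ} {p : ℕ → ℕ → ℕ} (hp : DiagBounds j p) (c i : ℕ) :
    max (p (i + 2) (i + 1 + j)) (p (i + 1) (i + 2 + j)) ≤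
        toggleDiag j p c (i + 1) (i + 1 + j) ∧
      toggleDiag j p c (i + 1) (i + 1 + j) ≤ min (p i (i + 1 + j)) (p (i + 1) (i + j)) := by
  rw [toggleDiag_succ]
  have := hp i
  omega

/-- The neighbours of a diagonal cell lie off the diagonal, so both passes reflect in the same
interval. The bounds keep the natural subtraction from truncating. -/
theorem toggleDiag_toggleDiag {j : ℕ} {p : ℕ → ℕ → ℕ} (hp : DiagBounds j p) (c : ℕ) :
    toggleDiag j (toggleDiag j p c) (p 0 j) = p := by
  ext i k
  by_cases h : k = i + j
  · subst h
    obtain - | i := i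
    · rw [zero_add, toggleDiag_zero]
    · rw [toggleDiag_succ, toggleDiag_of_ne (by omega), toggleDiag_of_ne (by omega),
        toggleDiag_of_ne (by omega), toggleDiag_of_ne (by omega), toggleDiag_succ]
      have := hp i
      omega
  · rw [toggleDiag_of_ne h, toggleDiag_of_ne h]

theorem IsTruncated.toggleDown {R n j : ℕ} {p : ℕ → ℕ → ℕ} (hp : IsTruncated R n j p) :
    IsTruncated R n (j + 1) (toggleDiag j p 0) := by
  have hb := hp.diagBounds.toggleDiag 0
  constructor
  · intro i k h
    by_cases hk : k = i + j
    · subst hk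
      obtain - | i := i
      · rw [zero_add, toggleDiag_zero]
      · have h1 := hb i
        have h2 := hp.zero i (i + 1 + j)
        have h3 := hp.zero (i + 1) (i + j)
        omega
    · rw [toggleDiag_of_ne hk]
      exact hp.zero i k (by omega)
  · intro i k h
    by_cases hk : k = i + j
    · subst hk
      obtain - | i := i
      · omega
      · rw [toggleDiag_of_ne (by omega)]
        have := (hb i).1
        rw [show i + 1 + j + 1 = i + 2 + j by omega]
        exact (le_max_right _ _).trans this
    · rw [toggleDiag_of_ne hk]
      by_cases hk' : k + 1 = i + j
      · obtain - | i := i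
        · omega
        · obtain rfl : k = i + j := by omega
          have := (hb i).2
          rw [show i + j + 1 = i + 1 + j by omega]
          exact this.trans (min_le_right _ _)
      · rw [toggleDiag_of_ne hk']
        exact hp.row i k (by omega)
  · intro i k h
    by_cases hk : k = i + j
    · subst hk
      obtain - | i := i
      · omega
      · rw [toggleDiag_of_ne (by omega)]
        exact (le_max_left _ _).trans (hb i).1
    · rw [toggleDiag_of_ne hk]
      by_cases hk' : k = i + 1 + j
      · subst hk'
        exact (hb i).2.trans (min_le_left _ _)
      · rw [toggleDiag_of_ne hk']
        exact hp.col i k (by omega)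

theorem IsTruncated.toggleUp {r n j : ℕ} {p : ℕ → ℕ → ℕ} (hp : IsTruncated (r + 1) n (j + 1) p)
    (hj : j < n) (m : ℕ) :
    IsTruncated (r + 1) n j (toggleDiag j p (m + max (p 1 j) (p 0 (j + 1)))) := by
  have hb := hp.diagBounds'.toggleDiag (m + max (p 1 j) (p 0 (j + 1)))
  have h0 := toggleDiag_zero j p (m + max (p 1 j) (p 0 (j + 1)))
  constructor
  · intro i k h
    by_cases hk : k = i + j
    · subst hk
      obtain - | i := i
      · omega
      · have h1 := hb i
        have h2 := hp.zero i (i + 1 + j)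
        have h3 := hp.zero (i + 1) (i + j)
        omega
    · rw [toggleDiag_of_ne hk]
      exact hp.zero i k (by omega)
  · intro i k h
    by_cases hk : k = i + j
    · subst hk
      obtain - | i := i
      · rw [toggleDiag_of_ne (by omega)]
        simp only [zero_add, h0]
        omega
      · rw [toggleDiag_of_ne (by omega)]
        have := (hb i).1
        rw [show i + 1 + j + 1 = i + 2 + j by omega]
        exact (le_max_right _ _).trans this
    · rw [toggleDiag_of_ne hk]
      by_cases hk' : k + 1 = i + j
      · obtain - | i := i
        · omega
        · obtain rfl : k = i + j := by omega
          have := (hb i).2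
          rw [show i + j + 1 = i + 1 + j by omega]
          exact this.trans (min_le_right _ _)
      · rw [toggleDiag_of_ne hk']
        exact hp.row i k (by omega)
  · intro i k h
    by_cases hk : k = i + j
    · subst hk
      obtain - | i := i
      · rw [toggleDiag_of_ne (by omega)]
        simp only [zero_add, h0]
        omega
      · rw [toggleDiag_of_ne (by omega)]
        exact (le_max_left _ _).trans (hb i).1
    · rw [toggleDiag_of_ne hk]
      by_cases hk' : k = i + 1 + j
      · subst hk'
        exact (hb i).2.trans (min_le_left _ _)
      · rw [toggleDiag_of_ne hk']
        exact hp.col i k (by omega)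

/-- Removing the `j`-th cell of the top row. -/
def toggleEquiv {r n j : ℕ} (hj : j < n) :
    TruncatedArray (r + 1) n j ≃ TruncatedArray (r + 1) n (j + 1) × ℕ where
  toFun p := (⟨toggleDiag j p.1 0, p.2.toggleDown⟩, p.1 0 j - max (p.1 1 j) (p.1 0 (j + 1)))
  invFun q := ⟨toggleDiag j q.1.1 (q.2 + max (q.1.1 1 j) (q.1.1 0 (j + 1))),
    q.1.2.toggleUp hj q.2⟩
  left_inv := by
    rintro ⟨p, hp⟩
    ext1
    dsimp only
    have h1 := hp.row 0 j (by omega)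
    have h2 := hp.col 0 j (by omega)
    rw [toggleDiag_of_ne (by omega), toggleDiag_of_ne (by omega), Nat.sub_add_cancel (by simp_all),
      toggleDiag_toggleDiag hp.diagBounds]
  right_inv := by
    rintro ⟨⟨p, hp⟩, m⟩
    have h0 : p 0 j = 0 := hp.zero 0 j (by omega)
    refine Prod.ext (Subtype.ext ?_) ?_ <;> dsimp only
    -- The removed cell holds `0`, so the value `0` written by `toFun` is the `p 0 j` that the
    -- involution restores.
    · rw [← h0, toggleDiag_toggleDiag hp.diagBounds']
    · rw [toggleDiag_zero, toggleDiag_of_ne (by omega), toggleDiag_of_ne (by omega)]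
      omega

/-! ### Conservation of weight -/

/-- The sum of the entries in an `R × n` box. -/
def boxSum (R n : ℕ) (p : ℕ → ℕ → ℕ) : ℕ := ∑ i ∈ range R, ∑ k ∈ range n, p i k

/-- The sum of the first `R` entries of the diagonal that starts at `(0, j)`. -/
def diagSum (R j : ℕ) (p : ℕ → ℕ → ℕ) : ℕ := ∑ i ∈ range R, p i (i + j)

/-- The sum of the first `R` entries of the diagonal that starts at `(1, j)`. -/
def lowerDiagSum (R j : ℕ) (p : ℕ → ℕ → ℕ) : ℕ := ∑ i ∈ range R, p (i + 1) (i + j)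

/-- The weight that is preserved by `toggleEquiv`. -/
def truncWeight (R n j t : ℕ) (p : ℕ → ℕ → ℕ) : ℤ :=
  boxSum R n p + (t + 1) * lowerDiagSum R 0 p - (j + t + 1) * lowerDiagSum R j p +
    (j + t) * diagSum R j p

/-- The `max` below one diagonal cell and the `min` above the next involve the same two entries, so
they add up to those entries; only a `max` at each end is left over. -/
theorem sum_toggleDiag_add {j : ℕ} {p : ℕ → ℕ → ℕ} (hp : DiagBounds j p) (c R : ℕ) :
    ∑ i ∈ range R, toggleDiag j p c (i + 1) (i + 1 + j) + ∑ i ∈ range R, p (i + 1) (i + 1 + j) +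
        max (p 1 j) (p 0 (j + 1)) =
      ∑ i ∈ range R, p (i + 1) (i + j) + ∑ i ∈ range R, p i (i + (j + 1)) +
        max (p (R + 1) (R + j)) (p R (R + (j + 1))) := by
  induction R with
  | zero => simp
  | succ R ih =>
    simp only [sum_range_succ]
    have h1 := hp R
    have h2 := toggleDiag_succ j p c R
    rw [show R + 1 + (j + 1) = R + 2 + j by omega]
    rw [show R + (j + 1) = R + 1 + j by omega] at ih ⊢
    rw [show R + 1 + 1 = R + 2 by omega]
    omega

theorem boxSum_toggleDiag {R n j : ℕ} {p q : ℕ → ℕ → ℕ} (hp : ∀ i k, n ≤ k → p i k = 0)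
    (hq : ∀ i k, n ≤ k → q i k = 0) (h : ∀ i k, k ≠ i + j → q i k = p i k) :
    boxSum R n p + diagSum R j q = boxSum R n q + diagSum R j p := by
  simp only [boxSum, diagSum, ← sum_add_distrib]
  refine sum_congr rfl fun i _ => ?_
  by_cases hi : i + j < n
  · rw [← add_sum_erase _ _ (mem_range.2 hi), ← add_sum_erase _ (q i) (mem_range.2 hi),
      sum_congr rfl fun k hk => h i k (ne_of_mem_erase hk)]
    ring
  · rw [hp i _ (by omega), hq i _ (by omega), sum_congr rfl fun k hk => h i k (by
      have := mem_range.1 hk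
      omega)]

/-- After the removal, the toggled diagonal is the lower diagonal for `j + 1`. The coefficients in
`truncWeight` are chosen so that the change is `j + t + 1` times the telescoped identity `h5`. -/
theorem truncWeight_toggle {r n j : ℕ} (t : ℕ) (hj : j < n)
    (p : TruncatedArray (r + 1) n j) :
    truncWeight (r + 1) n j t p =
      truncWeight (r + 1) n (j + 1) t (toggleEquiv hj p).1 +
        (j + t + 1) * (toggleEquiv hj p).2 := by
  obtain ⟨p, hp⟩ := p
  have hq := hp.toggleDown
  simp only [toggleEquiv, Equiv.coe_fn_mk]
  have h1 := boxSum_toggleDiag (R := r + 1) (n := n) (j := j) (fun i k h => hp.zero i k (by omega))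
    (fun i k h => hq.zero i k (by omega)) (fun i k h => toggleDiag_of_ne (p := p) (c := 0) h)
  have h2 := sum_toggleDiag_add hp.diagBounds 0 (r + 1)
  -- Entries below the box vanish, which kills the far end of the telescoped sum and lets the sums
  -- be shifted by one.
  have e1 : p (r + 1 + 1) (r + 1 + j) = 0 := hp.zero _ _ (by omega)
  have e2 : p (r + 1) (r + 1 + (j + 1)) = 0 := hp.zero _ _ (by omega)
  have e3 : p (r + 1) (r + 1 + j) = 0 := hp.zero _ _ (by omega)
  have e4 : toggleDiag j p 0 (r + 1) (r + 1 + j) = 0 := hq.zero _ _ (by omega)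
  have d1 : diagSum (r + 1) j p =
      ∑ i ∈ range (r + 1), p (i + 1) (i + 1 + j) + p 0 j := by
    have := sum_range_succ' (fun i => p i (i + j)) (r + 1)
    rw [sum_range_succ, e3] at this
    simpa [diagSum] using this
  have d2 : diagSum (r + 1) j (toggleDiag j p 0) =
      ∑ i ∈ range (r + 1), toggleDiag j p 0 (i + 1) (i + 1 + j) := by
    have := sum_range_succ' (fun i => toggleDiag j p 0 i (i + j)) (r + 1)
    rw [sum_range_succ, e4, zero_add j, toggleDiag_zero] at this
    simpa [diagSum] using this
  have d3 : lowerDiagSum (r + 1) (j + 1) (toggleDiag j p 0) =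
      diagSum (r + 1) j (toggleDiag j p 0) := by
    rw [d2]
    refine sum_congr rfl fun i _ => ?_
    rw [show i + (j + 1) = i + 1 + j by omega]
  have d4 : diagSum (r + 1) (j + 1) (toggleDiag j p 0) = diagSum (r + 1) (j + 1) p :=
    sum_congr rfl fun i _ => toggleDiag_of_ne (by omega)
  have d5 : lowerDiagSum (r + 1) 0 (toggleDiag j p 0) = lowerDiagSum (r + 1) 0 p :=
    sum_congr rfl fun i _ => toggleDiag_of_ne (by omega)
  have h3 := hp.row 0 j (by omega)
  have h4 := hp.col 0 j (by omega)
  have h5 : diagSum (r + 1) j p + diagSum (r + 1) j (toggleDiag j p 0) =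
      lowerDiagSum (r + 1) j p + diagSum (r + 1) (j + 1) p +
        (p 0 j - max (p 1 j) (p 0 (j + 1))) := by
    rw [e1, e2, ← d2] at h2
    simp only [lowerDiagSum]
    simp only [diagSum] at h2 d1 d2 ⊢
    rw [zero_add] at h4
    omega
  simp only [truncWeight]
  rw [d3, d4, d5]
  zify at h1 h5
  push_cast
  linear_combination h1 + (j + t + 1 : ℤ) * h5

theorem truncWeight_zero (R n t : ℕ) (p : ℕ → ℕ → ℕ) :
    truncWeight R n 0 t p = boxSum R n p + t * diagSum R 0 p := by
  simp [truncWeight]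

/-! ### Dismantling the box -/

theorem exists_equiv_isTruncated (r n t j : ℕ) (hj : j ≤ n) :
    ∃ e : TruncatedArray (r + 1) n 0 ≃ TruncatedArray (r + 1) n j × (Fin j → ℕ),
      ∀ p : TruncatedArray (r + 1) n 0, truncWeight (r + 1) n 0 t p =
        truncWeight (r + 1) n j t (e p).1 + ∑ k : Fin j, ((k : ℕ) + t + 1 : ℤ) * (e p).2 k := by
  induction j with
  | zero => exact ⟨(Equiv.prodUnique _ _).symm, fun p => by simp⟩
  | succ j ih =>
    obtain ⟨e, he⟩ := ih (by omega)
    refine ⟨e.trans (((toggleEquiv hj).prodCongr (Equiv.refl _)).trans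
      ((Equiv.prodAssoc _ _ _).trans
        ((Equiv.refl _).prodCongr (Fin.snocEquiv fun _ => ℕ)))), fun p => ?_⟩
    rw [he, truncWeight_toggle t hj, Fin.sum_univ_castSucc]
    simp [Fin.snocEquiv]
    ring

/-- Deleting an empty top row. -/
def dropRowEquiv (r n : ℕ) :
    TruncatedArray (r + 1) n n ≃ TruncatedArray r n 0 where
  toFun p := ⟨fun i k => p.1 (i + 1) k, fun i k h => p.2.zero _ _ (by omega),
    fun i k _ => p.2.row _ _ (by omega), fun i k _ => p.2.col _ _ (by omega)⟩
  invFun p := ⟨fun i k => if i = 0 then 0 else p.1 (i - 1) k, by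
    refine ⟨fun i k h => ?_, fun i k h => ?_, fun i k h => ?_⟩
    · split_ifs with hi
      · rfl
      · exact p.2.zero _ _ (by omega)
    · split_ifs with hi
      · rfl
      · exact p.2.row _ _ (by omega)
    · obtain - | i := i
      · simp [p.2.zero 0 k (by omega)]
      · simpa using p.2.col i k (by omega)⟩
  left_inv p := by
    ext i k
    obtain - | i := i
    · simp [p.2.zero 0 k (by omega)]
    · simp
  right_inv p := by
    ext i k
    simp

/-- The term `(t + 1) * lowerDiagSum R 0 p` is carried along the row for this moment: it becomes the
main-diagonal correction of the remaining box, with `t + 1` in place of `t`. -/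
theorem truncWeight_dropRow (r n t : ℕ) (p : TruncatedArray (r + 1) n n) :
    truncWeight (r + 1) n n t p = truncWeight r n 0 (t + 1) (dropRowEquiv r n p) := by
  obtain ⟨p, hp⟩ := p
  have h1 : lowerDiagSum (r + 1) n p = 0 := sum_eq_zero fun i _ => hp.zero _ _ (by omega)
  have h2 : diagSum (r + 1) n p = 0 := sum_eq_zero fun i _ => hp.zero _ _ (by omega)
  have h3 : boxSum (r + 1) n p = boxSum r n fun i k => p (i + 1) k := by
    rw [boxSum, sum_range_succ']
    refine add_eq_left.2 (sum_eq_zero fun k _ => hp.zero _ _ (by simp_all))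
  have h4 : lowerDiagSum (r + 1) 0 p = diagSum r 0 fun i k => p (i + 1) k := by
    rw [lowerDiagSum, sum_range_succ, hp.zero (r + 1) _ (by omega), add_zero]
    rfl
  rw [truncWeight_zero]
  simp only [truncWeight, dropRowEquiv, Equiv.coe_fn_mk, h1, h2, h3, h4]
  push_cast
  ring

theorem exists_equiv_box (r n t : ℕ) :
    ∃ e : TruncatedArray r n 0 ≃ (Fin r → Fin n → ℕ),
      ∀ p : TruncatedArray r n 0, truncWeight r n 0 t p =
        ∑ i : Fin r, ∑ k : Fin n, ((i : ℕ) + (k : ℕ) + t + 1 : ℤ) * e p i k := by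
  induction r generalizing t with
  | zero =>
    have h0 : IsTruncated 0 n 0 fun _ _ => 0 := ⟨by simp, by simp, by simp⟩
    let _ : Unique (TruncatedArray 0 n 0) :=
      ⟨⟨⟨_, h0⟩⟩, fun p => by
        ext i k
        exact p.2.zero i k (by omega)⟩
    exact ⟨Equiv.ofUnique _ _, fun p => by simp [truncWeight, boxSum, lowerDiagSum, diagSum]⟩
  | succ r ih =>
    obtain ⟨e, he⟩ := exists_equiv_isTruncated r n t n le_rfl
    obtain ⟨e', he'⟩ := ih (t + 1)
    refine ⟨e.trans ((((dropRowEquiv r n).trans e').prodCongr (Equiv.refl _)).trans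
      ((Equiv.prodComm _ _).trans (Fin.consEquiv fun _ => Fin n → ℕ))), fun p => ?_⟩
    rw [he, truncWeight_dropRow, he', Fin.sum_univ_succ]
    simp [Fin.consEquiv, add_comm, add_left_comm, add_assoc]

/-- Plane partitions in an `r × n` box are equinumerous with `r × n` arrays of natural numbers
whose cell `(i, k)` has weight `i + k + 1`. -/
theorem exists_equiv_box_boxSum (r n : ℕ) :
    ∃ e : TruncatedArray r n 0 ≃ (Fin r → Fin n → ℕ),
      ∀ p : TruncatedArray r n 0, boxSum r n p = ∑ i : Fin r, ∑ k : Fin n, ((i : ℕ) + k + 1) * e p i k := by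
  obtain ⟨e, he⟩ := exists_equiv_box r n 0
  refine ⟨e, fun p => ?_⟩
  have := he p
  rw [truncWeight_zero] at this
  zify
  simpa using this

/-! ### Plane partitions as arrays in a box -/

/-- A plane partition of `N` fits in an `N × N` box. -/
theorem PlanePartition.eq_zero_of_size_le (π : PlanePartition) {i k : ℕ}
    (h : π.size ≤ i ∨ π.size ≤ k) : π.entries (i, k) = 0 := by
  by_contra h0
  have hrow : ∀ k, Antitone fun i => π.entries (i, k) := fun k =>
    antitone_nat_of_succ_le fun i => π.col_le i k
  have hcol : ∀ i, Antitone fun k => π.entries (i, k) := fun i =>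
    antitone_nat_of_succ_le fun k => π.row_le i k
  -- By monotonicity, a nonzero entry makes all cells before it in its row or column nonzero, each
  -- adding at least `1` to the size.
  have key : ∀ (n : ℕ) (f : ℕ → ℕ × ℕ), Function.Injective f →
      (∀ a ≤ n, π.entries (f a) ≠ 0) → n < π.size := by
    intro n f hf hn
    calc n < ((range (n + 1)).image f).card := by
          rw [card_image_of_injective _ hf, card_range]; omega
      _ ≤ π.entries.support.card := card_le_card fun x hx => by
          obtain ⟨a, ha, rfl⟩ := mem_image.1 hx
          exact Finsupp.mem_support_iff.2 (hn a (Nat.lt_succ_iff.1 (mem_range.1 ha)))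
      _ ≤ π.size := by
          rw [card_eq_sum_ones]
          exact sum_le_sum fun x hx => Nat.one_le_iff_ne_zero.2 (Finsupp.mem_support_iff.1 hx)
  rcases h with h | h
  · refine (key i (fun a => (a, k)) (fun a b h => (Prod.ext_iff.1 h).1) fun a ha => ?_).not_ge h
    have := hrow k ha
    dsimp only at this
    omega
  · refine (key k (fun a => (i, a)) (fun a b h => (Prod.ext_iff.1 h).2) fun a ha => ?_).not_ge h
    have := hcol i ha
    dsimp only at this
    omega

theorem PlanePartition.ext_entries {π ρ : PlanePartition} (h : π.entries = ρ.entries) :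
    π = ρ := by
  cases π; cases ρ; simp_all

/-- The plane partition given by an array in a box. -/
noncomputable def IsTruncated.toPlanePartition {r n : ℕ} {p : ℕ → ℕ → ℕ} (hp : IsTruncated r n 0 p) :
    PlanePartition where
  entries := Finsupp.onFinset (range r ×ˢ range n) (fun c => p c.1 c.2) fun c hc => by
    by_contra h
    refine hc (hp.zero _ _ ?_)
    simp at h
    omega
  row_le i j := hp.row i j (by omega)
  col_le i j := hp.col i j (by omega)

theorem IsTruncated.size_toPlanePartition {r n : ℕ} {p : ℕ → ℕ → ℕ} (hp : IsTruncated r n 0 p) :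
    hp.toPlanePartition.size = boxSum r n p := by
  rw [PlanePartition.size, toPlanePartition, Finsupp.onFinset_sum _ fun _ => rfl, sum_product]
  rfl

theorem PlanePartition.isTruncated {N : ℕ} (π : PlanePartition) (h : π.size ≤ N) :
    IsTruncated N N 0 fun i k => π.entries (i, k) :=
  ⟨fun i k hik => π.eq_zero_of_size_le (by omega), fun i k _ => π.row_le i k,
    fun i k _ => π.col_le i k⟩

theorem PlanePartition.toPlanePartition_isTruncated {N : ℕ} (π : PlanePartition)
    (h : π.size ≤ N) : (π.isTruncated h).toPlanePartition = π :=
  PlanePartition.ext_entries (Finsupp.ext fun _ => rfl)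

/-- The plane partitions of `N` as arrays in an `N × N` box. -/
noncomputable def planePartitionsOfEquiv (N : ℕ) :
    planePartitionsOf N ≃ {p : TruncatedArray N N 0 // boxSum N N p = N} where
  toFun π := ⟨⟨_, π.1.isTruncated π.2.le⟩, by
    have h := (π.1.isTruncated π.2.le).size_toPlanePartition
    rw [π.1.toPlanePartition_isTruncated π.2.le] at h
    exact h.symm.trans π.2⟩
  invFun p := ⟨p.1.2.toPlanePartition, p.1.2.size_toPlanePartition.trans p.2⟩
  left_inv π := Subtype.ext (π.1.toPlanePartition_isTruncated π.2.le)
  right_inv _ := rfl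

/-! ### Multisets and the product formula -/

/-- A multiset of degree `N` is a multiplicity function on any family of elements that contains all
those of degree at most `N`. -/
noncomputable def jOnEquiv {S ι : Type*} [Fintype ι] (d : S → ℕ+) (N : ℕ) (e : ι → S)
    (he : Function.Injective e) (hN : ∀ s, (d s : ℕ) ≤ N → s ∈ Set.range e) :
    JOn d N ≃ {l : ι → ℕ // ∑ i, l i * (d (e i) : ℕ) = N} := by
  classical
  have hsub : ∀ f ∈ JOn d N, ∀ s ∈ f, s ∈ Set.range e := fun f hf s hs =>
    hN s ((Multiset.single_le_sum (by simp) _ (Multiset.mem_map_of_mem _ hs)).trans_eq hf)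
  have hcount : ∀ (l : ι → ℕ) (i : ι),
      (∑ x, Multiset.replicate (l x) (e x)).count (e i) = l i := fun l i => by
    rw [Multiset.count_sum', sum_eq_single i]
    · simp
    · intro x _ hx
      rw [Multiset.count_replicate, if_neg fun h => hx (he h)]
    · simp
  have hsum : ∀ l : ι → ℕ, ((∑ x, Multiset.replicate (l x) (e x)).map fun s => (d s : ℕ)).sum =
      ∑ i, l i * (d (e i) : ℕ) := fun l => by
    have h := map_sum ((Multiset.sumAddMonoidHom : Multiset ℕ →+ ℕ).comp
      (Multiset.mapAddMonoidHom fun s => (d s : ℕ))) (fun x => Multiset.replicate (l x) (e x)) univ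
    rw [AddMonoidHom.comp_apply] at h
    exact h.trans (sum_congr rfl fun x _ => by simp)
  have hext : ∀ f ∈ JOn d N, ∑ x, Multiset.replicate (f.count (e x)) (e x) = f := fun f hf => by
    ext s
    by_cases hs : s ∈ Set.range e
    · obtain ⟨i, rfl⟩ := hs
      exact hcount _ i
    · rw [Multiset.count_eq_zero_of_notMem fun h => hs (hsub f hf s h), Multiset.count_sum']
      refine sum_eq_zero fun x _ => ?_
      rw [Multiset.count_replicate, if_neg fun h => hs ⟨x, h⟩]
  exact
    { toFun := fun f => ⟨fun i => f.1.count (e i), by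
        rw [← hsum, hext f.1 f.2]
        exact f.2⟩
      invFun := fun l => ⟨∑ x, Multiset.replicate (l.1 x) (e x), (hsum l.1).trans l.2⟩
      left_inv := fun f => Subtype.ext (hext f.1 f.2)
      right_inv := fun l => Subtype.ext (funext (hcount l.1)) }

theorem finite_weighted {ι : Type*} [Fintype ι] (d : ι → ℕ+) (N : ℕ) :
    Finite {l : ι → ℕ // ∑ i, l i * (d i : ℕ) = N} := by
  refine Set.Finite.to_subtype
    ((Set.Finite.pi' fun _ : ι => Set.finite_Iic N).subset fun l hl i => ?_)
  calc l i ≤ l i * (d i : ℕ) := Nat.le_mul_of_pos_right _ (d i).pos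
    _ ≤ ∑ i, l i * (d i : ℕ) := single_le_sum (f := fun i => l i * (d i : ℕ)) (by simp) (mem_univ i)
    _ = N := hl

theorem invOfUnit_one_sub_X_pow (k : ℕ+) :
    PowerSeries.invOfUnit (1 - (PowerSeries.X : PowerSeries ℤ) ^ (k : ℕ)) 1 =
      PowerSeries.mk fun n => if (k : ℕ) ∣ n then 1 else 0 := by
  set g : PowerSeries ℤ := PowerSeries.mk fun n => if (k : ℕ) ∣ n then 1 else 0
  have hg : (1 - (PowerSeries.X : PowerSeries ℤ) ^ (k : ℕ)) * g = 1 := by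
    ext n
    rw [sub_mul, one_mul, map_sub, PowerSeries.coeff_X_pow_mul', PowerSeries.coeff_one]
    simp only [g, PowerSeries.coeff_mk]
    have hk := k.pos
    by_cases hn : (k : ℕ) ≤ n
    · have : (k : ℕ) ∣ n - k ↔ (k : ℕ) ∣ n := (Nat.dvd_sub_iff_left hn dvd_rfl)
      simp [hn, this]
      omega
    · obtain rfl | h0 := eq_or_ne n 0
      · simp
      · rw [if_neg fun h => hn (Nat.le_of_dvd (by omega) h), if_neg hn, if_neg h0, sub_zero]
  have h1 := PowerSeries.mul_invOfUnit (1 - (PowerSeries.X : PowerSeries ℤ) ^ (k : ℕ)) 1 (by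
    simp [zero_pow k.ne_zero])
  calc _ = PowerSeries.invOfUnit (1 - (PowerSeries.X : PowerSeries ℤ) ^ (k : ℕ)) 1 *
      ((1 - (PowerSeries.X : PowerSeries ℤ) ^ (k : ℕ)) * g) := by rw [hg, mul_one]
    _ = _ := by rw [← mul_assoc, mul_comm (PowerSeries.invOfUnit _ _), h1, one_mul]

theorem coeff_prod_invOfUnit {ι : Type*} [Fintype ι] (d : ι → ℕ+) (N : ℕ) :
    (PowerSeries.coeff N
        (∏ i, PowerSeries.invOfUnit (1 - (PowerSeries.X : PowerSeries ℤ) ^ (d i : ℕ)) 1) : ℤ) =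
      Nat.card {l : ι → ℕ // ∑ i, l i * (d i : ℕ) = N} := by
  classical
  have := finite_weighted d N
  have := Fintype.ofFinite {l : ι → ℕ // ∑ i, l i * (d i : ℕ) = N}
  simp only [PowerSeries.coeff_prod, invOfUnit_one_sub_X_pow, PowerSeries.coeff_mk,
    prod_ite_zero, prod_const_one, sum_boole]
  rw [Nat.card_eq_fintype_card, ← card_univ]
  congr 1
  symm
  -- The exponent taken from factor `i` is `l i * d i`, which runs over the multiples of `d i`.
  refine card_bij (fun l _ => Finsupp.equivFunOnFinite.symm fun i => l.1 i * (d i : ℕ)) ?_ ?_ ?_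
  · intro l _
    simp [l.2]
  · intro l _ l' _ h
    ext i
    have := DFunLike.congr_fun h i
    simpa using this
  · intro f hf
    simp only [mem_filter, mem_finsuppAntidiag, mem_univ, true_implies] at hf
    refine ⟨⟨fun i => f i / d i, ?_⟩, mem_univ _, ?_⟩
    · rw [← hf.1.1]
      exact sum_congr rfl fun i _ => Nat.div_mul_cancel (hf.2 i)
    · ext i
      simp [Nat.div_mul_cancel (hf.2 i)]

/-- The `k` compositions of `k` into at most two parts. -/
def TwoPartComposition.ofFin (x : Σ k : ℕ+, Fin k) : TwoPartComposition :=
  (⟨x.1 - x.2, Nat.sub_pos_of_lt x.2.2⟩, x.2)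

theorem TwoPartComposition.degree_ofFin (x : Σ k : ℕ+, Fin k) : (ofFin x).degree = x.1 :=
  PNat.eq (Nat.sub_add_cancel x.2.2.le)

theorem TwoPartComposition.ofFin_bijective : Function.Bijective ofFin := by
  refine ⟨fun x y h => ?_, fun c => ⟨⟨c.degree, c.2, ?_⟩, ?_⟩⟩
  · have h1 := degree_ofFin x
    rw [h, degree_ofFin] at h1
    obtain ⟨k, b⟩ := x
    obtain ⟨_, b'⟩ := y
    obtain rfl : _ = k := h1
    have h2 : (b : ℕ) = b' := congrArg Prod.snd h
    rw [Fin.ext h2]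
  · have := c.1.pos
    change c.2 < (c.1 : ℕ) + c.2
    omega
  · exact Prod.ext (PNat.eq (Nat.add_sub_cancel (n := (c.1 : ℕ)) (m := c.2))) rfl

theorem ncard_degree_eq (k : ℕ+) :
    {c : TwoPartComposition | c.degree = k}.ncard = (k : ℕ) := by
  have : {c : TwoPartComposition | c.degree = k} =
      Set.range fun b : Fin k => TwoPartComposition.ofFin ⟨k, b⟩ := by
    ext c
    constructor
    · obtain ⟨x, rfl⟩ := TwoPartComposition.ofFin_bijective.2 c
      rintro rfl
      rw [TwoPartComposition.degree_ofFin]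
      exact ⟨x.2, rfl⟩
    · rintro ⟨b, rfl⟩
      exact TwoPartComposition.degree_ofFin _
  rw [this, ← Set.image_univ, Set.ncard_image_of_injective, Set.ncard_univ, Nat.card_fin]
  intro b b' h
  simpa using TwoPartComposition.ofFin_bijective.1 h

/-- Extra factors in `K` are harmless: compositions of degree above `N` have multiplicity `0`. Hence
each coefficient of the partial products is eventually constant, as `hasProd_J` needs. -/
theorem coeff_prod_eq_ncard_J {N : ℕ} {K : Finset ℕ+} (hK : ∀ k : ℕ+, (k : ℕ) ≤ N → k ∈ K) :
    (PowerSeries.coeff N (∏ k ∈ K,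
        (PowerSeries.invOfUnit (1 - (PowerSeries.X : PowerSeries ℤ) ^ (k : ℕ)) 1) ^ (k : ℕ)) : ℤ) =
      (J N).ncard := by
  let e : (Σ k : K, Fin (k : ℕ+)) → TwoPartComposition := fun x =>
    TwoPartComposition.ofFin ⟨x.1, x.2⟩
  have he : Function.Injective e := fun x y h => by
    obtain ⟨⟨k, hk⟩, b⟩ := x
    obtain ⟨⟨k', hk'⟩, b'⟩ := y
    have := TwoPartComposition.ofFin_bijective.1 h
    obtain ⟨h1, h2⟩ := Sigma.mk.inj_iff.1 this
    dsimp only at h1 h2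
    subst h1
    rw [eq_of_heq h2]
  have hN : ∀ c : TwoPartComposition, (c.degree : ℕ) ≤ N → c ∈ Set.range e := fun c hc => by
    obtain ⟨x, rfl⟩ := TwoPartComposition.ofFin_bijective.2 c
    rw [TwoPartComposition.degree_ofFin] at hc
    exact ⟨⟨⟨x.1, hK _ hc⟩, x.2⟩, rfl⟩
  rw [← Nat.card_coe_set_eq, J, Nat.card_congr (jOnEquiv _ N e he hN), ← coeff_prod_invOfUnit,
    Fintype.prod_sigma, ← prod_coe_sort K]
  simp [e, TwoPartComposition.degree_ofFin]

theorem hasProd_J :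
    HasProd
      (fun k : ℕ+ =>
        (PowerSeries.invOfUnit (1 - (PowerSeries.X : PowerSeries ℤ) ^ (k : ℕ)) 1) ^ (k : ℕ))
      (PowerSeries.mk fun N => ((J N).ncard : ℤ)) := by
  rw [HasProd, SummationFilter.unconditional_filter,
    PowerSeries.WithPiTopology.tendsto_iff_coeff_tendsto]
  intro N
  rw [PowerSeries.coeff_mk]
  have hfin : {k : ℕ+ | (k : ℕ) ≤ N}.Finite :=
    (Set.finite_Iic N).preimage PNat.coe_injective.injOn
  refine tendsto_const_nhds.congr' ?_
  filter_upwards [Filter.eventually_ge_atTop hfin.toFinset] with K hK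
  exact (coeff_prod_eq_ncard_J fun k hk => hK (hfin.mem_toFinset.2 hk)).symm

/-- The compositions indexing the cells of an `N × N` box. -/
def TwoPartComposition.ofCell {N : ℕ} (c : Fin N × Fin N) : TwoPartComposition :=
  (Nat.succPNat c.1, c.2)

/-! ### Bijections with plane partitions, unsigned and signed -/

theorem exists_equiv_planePartitionsOf (N : ℕ) :
    Nonempty (J N ≃ planePartitionsOf N) ∧ (J N).Finite := by
  have he : Function.Injective (TwoPartComposition.ofCell (N := N)) := fun c c' h => by
    have h1 := Nat.succPNat_injective (congrArg Prod.fst h)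
    have h2 : (c.2 : ℕ) = c'.2 := congrArg Prod.snd h
    exact Prod.ext (Fin.ext h1) (Fin.ext h2)
  have hN : ∀ c : TwoPartComposition, (c.degree : ℕ) ≤ N →
      c ∈ Set.range (TwoPartComposition.ofCell (N := N)) := fun c hc => by
    change (c.1 : ℕ) + c.2 ≤ N at hc
    have := c.1.pos
    refine ⟨(⟨c.1.natPred, by rw [PNat.natPred]; omega⟩, ⟨c.2, by omega⟩), ?_⟩
    exact Prod.ext (PNat.succPNat_natPred _) rfl
  have E := jOnEquiv TwoPartComposition.degree N _ he hN
  refine ⟨?_, ?_⟩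
  · obtain ⟨e, h⟩ := exists_equiv_box_boxSum N N
    refine ⟨E.trans (Equiv.trans ?_ (planePartitionsOfEquiv N).symm)⟩
    refine (Equiv.subtypeEquiv (e.trans (Equiv.curry (Fin N) (Fin N) ℕ).symm) fun p => ?_).symm
    rw [h, Fintype.sum_prod_type]
    simp [TwoPartComposition.degree, TwoPartComposition.ofCell, mul_comm, add_right_comm]
  · have := finite_weighted (fun c : Fin N × Fin N => (TwoPartComposition.ofCell c).degree) N
    exact Set.finite_coe_iff.1 (Finite.of_equiv _ E.symm)

theorem mem_JSigned {N : ℕ} {f : Multiset TwoPartComposition × Multiset TwoPartComposition} :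
    f ∈ JSigned N ↔ (f.1.map fun s => (s.degree : ℕ)).sum +
      (f.2.map fun s => (s.degree : ℕ)).sum = N := by
  simp [JSigned, JSignedOn, JPairOn, JOn]

/-- Gluing the bijections over all `N` gives one degree-preserving bijection, which can then be
applied to each component of a pair. -/
theorem exists_equiv_size : ∃ e : Multiset TwoPartComposition ≃ PlanePartition,
    ∀ f, (e f).size = (f.map fun s => (s.degree : ℕ)).sum := by
  let E := fun N => (exists_equiv_planePartitionsOf N).1.some
  refine ⟨(Equiv.sigmaFiberEquiv _).symm.trans ((Equiv.sigmaCongrRight E).trans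
    (Equiv.sigmaFiberEquiv PlanePartition.size)), fun f => ?_⟩
  exact (E _ ⟨f, rfl⟩).2

theorem nonempty_JSigned_equiv (N : ℕ) : Nonempty (JSigned N ≃ planePartitionPairsOf N) := by
  obtain ⟨e, he⟩ := exists_equiv_size
  refine ⟨Equiv.subtypeEquiv (e.prodCongr e) fun f => ?_⟩
  rw [mem_JSigned]
  simp [planePartitionPairsOf, he]

theorem exists_finset_JSigned (N : ℕ) : ∃ s : ℕ → Finset (Multiset TwoPartComposition),
    (∀ N, J N = s N) ∧ JSigned N = ((antidiagonal N).biUnion fun q => s q.1 ×ˢ s q.2 :) := by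
  classical
  refine ⟨fun N => (exists_equiv_planePartitionsOf N).2.toFinset, by simp, ?_⟩
  ext f
  simp [JSigned, JSignedOn, JPairOn, J]

theorem finite_JSigned (N : ℕ) : (JSigned N).Finite := by
  obtain ⟨s, -, hs⟩ := exists_finset_JSigned N
  rw [hs]
  exact finite_toSet _

theorem ncard_JSigned (N : ℕ) :
    (JSigned N).ncard = ∑ q ∈ antidiagonal N, (J q.1).ncard * (J q.2).ncard := by
  obtain ⟨s, hJ, hs⟩ := exists_finset_JSigned N
  rw [hs, Set.ncard_coe_finset, card_biUnion]
  · simp [hJ]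
  · intro q _ q' _ hq
    rw [Function.onFun, disjoint_left]
    rintro f hf hf'
    rw [mem_product, ← mem_coe, ← mem_coe, ← hJ, ← hJ] at hf hf'
    exact hq (Prod.ext (hf.1.symm.trans hf'.1) (hf.2.symm.trans hf'.2))

end LoopBraid

theorem mainTheorem5 :
    -- there are exactly `k` compositions of `k` into at most two parts
    (∀ k : ℕ+, {c : LoopBraid.TwoPartComposition |
      LoopBraid.TwoPartComposition.degree c = k}.ncard = (k : ℕ)) ∧
    -- `J_N` is finite, with generating function `∏_{k ≥ 1} (1 - x ^ k) ^ (-k)`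
    (∀ N : ℕ, (LoopBraid.J N).Finite) ∧
    HasProd
      (fun k : ℕ+ =>
        (PowerSeries.invOfUnit (1 - (PowerSeries.X : PowerSeries ℤ) ^ (k : ℕ)) 1) ^ (k : ℕ))
      (PowerSeries.mk fun N => ((LoopBraid.J N).ncard : ℤ)) ∧
    -- `|J_N|` is the number of plane partitions of `N`
    (∀ N : ℕ, (LoopBraid.planePartitionsOf N).Finite ∧
      (LoopBraid.J N).ncard = (LoopBraid.planePartitionsOf N).ncard) ∧
    -- `J_N^±` is finite and equinumerous with the ordered pairs of plane partitions of total
    -- degree `N`; its generating function is the square of that of `J_N`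
    (∀ N : ℕ, (LoopBraid.JSigned N).Finite ∧
      Nonempty (LoopBraid.JSigned N ≃ LoopBraid.planePartitionPairsOf N)) ∧
    (PowerSeries.mk fun N => ((LoopBraid.JSigned N).ncard : ℤ)) =
      (PowerSeries.mk fun N => ((LoopBraid.J N).ncard : ℤ)) ^ 2 := by
  open LoopBraid in
  refine ⟨ncard_degree_eq, fun N => (exists_equiv_planePartitionsOf N).2, hasProd_J,
    fun N => ?_, fun N => ⟨finite_JSigned N, nonempty_JSigned_equiv N⟩, ?_⟩
  · obtain ⟨⟨e⟩, h⟩ := exists_equiv_planePartitionsOf N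
    have := h.to_subtype
    exact ⟨Set.finite_coe_iff.1 (Finite.of_equiv _ e), Nat.card_congr e⟩
  · ext N
    simp [pow_two, PowerSeries.coeff_mul, ncard_JSigned]
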